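/- **Setting.** Let $G=(X,A)$ be a finite simple graph with at least one edge, regarded as a symmetric digraph with arc set $A$; the arc $e\in A$ has origin $o(e)$, terminus $t(e)$ and inverse arc $\bar e$. A rotation system $(G,\rho,\tau)$ consists of a permutation $\rho$ of $A$ that, for every vertex $x$, permutes the arcs with terminus $x$ in one single cycle, and a map $\tau:A\to\mathbb Z_2$ with $\tau(\bar e)=\tau(e)$. *Double covering.* Its arc set $A^\tau$ consists of the lifts $v=(e,j)$, $e\in A$, $j\in\mathbb Z_2$, with terminus $(t(e),j)$ and origin $(o(e),j+\tau(e))$; put $\bar v=(\bar e,j+\tau(e))$, $\tau(v)=\tau(e)$, $\tilde\rho(e,0)=(\rho(e),0)$ and $\tilde\rho(e,1)=(\rho^{-1}(e),1)$. *Faces.* A facial walk is a cycle $(e_0,\dots,e_{r-1})$ of the permutation $v\mapsto\overline{\tilde\rho(v)}$ of $A^\tau$. The inverse of a facial walk is obtained by traversing it backwards on the opposite sheets, i.e. it consists of the arcs $(\bar e,j+\tau(e)+1)$ for its arcs $(e,j)$. The set $F$ of faces is the set of facial walks up to inversion; for each $f\in F$ fix one of its two facial walks, again denoted $f$, and let $|f|=r$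 be its length. For $v,w\in f$ let $\mathrm{dist}_f(v,w)$ be the least number of steps from $w$ to $v$ along $f$, so $\mathrm{dist}_f(e_l,e_m)\equiv l-m \pmod r$. Let $f\cap\bar f$ be the set of arcs $v\in f$ with $\bar v\in f$ (both $v$ and $\bar v$ are elements). *Quantum walk.* Let $C=\begin{bmatrix}a&b\\c&d\end{bmatrix}$ be a unitary matrix. Consider the infinite graph whose vertices are the elements $v\in A^\tau$ and additional vertices $x_v$ ($v\in A^\tau$), with a bridge arc $\beta_v$ from $v$ to $\bar v$, island arcs $\xi_v^-$ from $v$ to $x_v$ and $\xi_v^+$ from $x_v$ to $\tilde\rho(v)$, and at each $x_v$ a semi-infinite path (tail) with arcs $\epsilon_{v,0},\epsilon_{v,1},\dots$ directed towards $x_v$ ($\epsilon_{v,0}$ ends at $x_v$) and their inverses $\bar\epsilon_{v,n}$ (hedgehog tails). The time evolution of $\Psi_t$, $t\ge0$, is $$\Psi_{t+1}(\xi_v^-)=a\Psi_t(\xi^+_{\tilde\rho^{-1}(v)})+b\Psi_t(\beta_{\bar v}),\qquad \Psi_{t+1}(\beta_v)=(-1)^{\tau(v)}\{c\Psi_t(\xi^+_{\tilde\rho^{-1}(v)})+d\Psi_t(\beta_{\bar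 v})\},$$ $$\Psi_{t+1}(\xi_v^+)=a\Psi_t(\xi_v^-)+b\Psi_t(\epsilon_{v,0}),\qquad \Psi_{t+1}(\bar\epsilon_{v,0})=c\Psi_t(\xi_v^-)+d\Psi_t(\epsilon_{v,0}),$$ $$\Psi_{t+1}(\epsilon_{v,n})=\Psi_t(\epsilon_{v,n+1}),\qquad \Psi_{t+1}(\bar\epsilon_{v,n+1})=\Psi_t(\bar\epsilon_{v,n}).$$ For an inflow $\alpha\in\mathbb C^{A^\tau}$ the initial state is $\Psi_0(\epsilon_{v,n})=\alpha(v)$ for all $n$ and $\Psi_0=0$ on all other arcs. The stationary state is the pointwise limit $\Psi_\infty=\lim_{t\to\infty}\Psi_t$, and the comfortability is $$\mathcal E=\frac12\sum_{v\in A^\tau}\left(|\Psi_\infty(\beta_v)|^2+|\Psi_\infty(\xi_v^-)|^2+|\Psi_\infty(\xi_v^+)|^2\right).$$ **Theorem.** Assume that $d\in\mathbb R$, that $\omega:=-\det C=1$, that $a$ is a positive real number, and that $b\ne0$. Then $\Psi_t$ converges pointwise for every inflow $\alpha$; and if $\alpha$ is chosen uniformly at random in $\{\delta_v : v\in A^\tau\}$,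 that is, one tail chosen uniformly at random receives the inflow $1$, then $$\mathbb E[\mathcal E]=\frac1{|A|}\,\frac{2+|b|^2}{2|b|^2}\sum_{f\in F}|f|\,\frac{1+a^{|f|}}{1-a^{|f|}}-\frac1{|A|}\,\frac{a}{|b|^2}\sum_{f\in F}\frac1{1-a^{|f|}}\sum_{e\in f\cap\bar f}\left(a^{\mathrm{dist}_f(e,\bar e)}+a^{\mathrm{dist}_f(\bar e,e)}\right).$$ -/

import Mathlib

open Filter Topology

namespace EmbeddedWalk

variable {V : Type*} {G : SimpleGraph V}

/-- A rotation system on a simple graph `G`. The arcs of `G` are its darts, the inverse of an arc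
`e` is `e.symm`, its origin is `e.fst` and its terminus is `e.snd`. The rotation permutes, in one
single cycle for each vertex `x`, the arcs with terminus `x`. The twist depends only on the
unoriented edge. -/
structure RotationSystem (G : SimpleGraph V) where
  rot : Equiv.Perm G.Dart
  rot_isCycleOn : ∀ x : V, rot.IsCycleOn {e : G.Dart | e.snd = x}
  twist : G.Dart → ZMod 2
  twist_symm : ∀ e : G.Dart, twist e.symm = twist e

/-- The arcs of the double covering graph of `G`, whose vertex set is `V × ZMod 2`: the pair
`(e, j)` is the lift of `e` with terminus `(e.snd, j)`; its origin is `(e.fst, j + τ(e))`. -/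
abbrev CoverArc (G : SimpleGraph V) : Type _ := G.Dart × ZMod 2

namespace RotationSystem

variable (R : RotationSystem G)

lemma rot_snd (e : G.Dart) : (R.rot e).snd = e.snd :=
  (R.rot_isCycleOn e.snd).1.mapsTo rfl

lemma zmod_two_add_self (j : ZMod 2) : j + j = 0 := by
  revert j; decide

/-- The inverse arc in the double covering graph. -/
def coverInv : Equiv.Perm (CoverArc G) where
  toFun x := (x.1.symm, x.2 + R.twist x.1)
  invFun x := (x.1.symm, x.2 + R.twist x.1)
  left_inv x := by
    simp [R.twist_symm, add_assoc, zmod_two_add_self]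
  right_inv x := by
    simp [R.twist_symm, add_assoc, zmod_two_add_self]

/-- The rotation of the double covering graph: `ρ` around the vertices of the sheet `0` and `ρ⁻¹`
around those of the sheet `1`. -/
def coverRot : Equiv.Perm (CoverArc G) where
  toFun x := (if x.2 = 0 then R.rot x.1 else R.rot⁻¹ x.1, x.2)
  invFun x := (if x.2 = 0 then R.rot⁻¹ x.1 else R.rot x.1, x.2)
  left_inv x := by
    by_cases h : x.2 = 0 <;> simp [h, Prod.ext_iff]
  right_inv x := by
    by_cases h : x.2 = 0 <;> simp [h, Prod.ext_iff]

/-- Exchange of the two sheets. -/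
def sheetSwap : Equiv.Perm (CoverArc G) where
  toFun x := (x.1, x.2 + 1)
  invFun x := (x.1, x.2 + 1)
  left_inv x := by
    simp [add_assoc, zmod_two_add_self]
  right_inv x := by
    simp [add_assoc, zmod_two_add_self]

/-- One step of a facial walk: after the arc `e` with terminus on the sheet `j` comes
`σ(ρ(e))` if `j = 0` and `σ(ρ⁻¹(e))` if `j = 1`, where `σ` is the inversion of arcs. The sheet
records the number modulo `2` of twisted edges traversed so far. -/
def faceNext : Equiv.Perm (CoverArc G) := R.coverInv * R.coverRot

/-- The chiral arc: the inverse arc on the opposite sheet. A facial walk traversed backwards on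
the opposite sheets passes through the chiral arcs of its arcs. -/
def chiral : Equiv.Perm (CoverArc G) := sheetSwap * R.coverInv

lemma chiral_chiral (x : CoverArc G) : R.chiral (R.chiral x) = x := by
  have h : x.2 + R.twist x.1 + 1 + R.twist x.1 + 1 = x.2 := by
    generalize x.2 = i
    generalize R.twist x.1 = j
    revert i j; decide
  simp [chiral, sheetSwap, coverInv, R.twist_symm, h]

lemma coverInv_coverInv (x : CoverArc G) : R.coverInv (R.coverInv x) = x :=
  R.coverInv.left_inv x

lemma sheetSwap_coverInv (x : CoverArc G) :
    sheetSwap (R.coverInv x) = R.coverInv (sheetSwap x) := by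
  simp [sheetSwap, coverInv, add_right_comm]

lemma coverRot_sheetSwap_coverRot (x : CoverArc G) :
    R.coverRot (sheetSwap (R.coverRot x)) = sheetSwap x := by
  obtain ⟨e, j⟩ := x
  have hj : j = 0 ∨ j = 1 := by revert j; decide
  have h1 : (1 : ZMod 2) + 1 = 0 := by decide
  rcases hj with rfl | rfl <;> simp [coverRot, sheetSwap, h1]

lemma faceNext_chiral_faceNext (x : CoverArc G) :
    R.faceNext (R.chiral (R.faceNext x)) = R.chiral x := by
  simp only [faceNext, chiral, Equiv.Perm.mul_apply]
  rw [coverInv_coverInv, coverRot_sheetSwap_coverRot, sheetSwap_coverInv]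

lemma chiral_conj : R.chiral * R.faceNext * R.chiral⁻¹ = R.faceNext⁻¹ := by
  ext1 x
  rw [Equiv.Perm.eq_inv_iff_eq]
  simp only [Equiv.Perm.mul_apply]
  rw [faceNext_chiral_faceNext]
  simp

lemma sameCycle_chiral {x y : CoverArc G} (h : R.faceNext.SameCycle x y) :
    R.faceNext.SameCycle (R.chiral x) (R.chiral y) := by
  rw [← Equiv.Perm.sameCycle_inv, ← R.chiral_conj, Equiv.Perm.sameCycle_conj]
  simpa using h

/-- A facial walk is never its own inverse. -/
lemma not_sameCycle_chiral (x : CoverArc G) : ¬ R.faceNext.SameCycle x (R.chiral x) := by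
  rintro ⟨i, hi⟩
  have hm (m : ℤ) : R.chiral ((R.faceNext ^ m) x) = (R.faceNext ^ (i - m)) x := by
    have h : R.chiral * R.faceNext ^ m * R.chiral⁻¹ = R.faceNext ^ (-m) := by
      rw [← conj_zpow, chiral_conj, inv_zpow']
    have h' := congrArg (fun p : Equiv.Perm (CoverArc G) => p (R.chiral x)) h
    simp only [Equiv.Perm.mul_apply] at h'
    rw [show R.chiral⁻¹ (R.chiral x) = x from R.chiral.symm_apply_apply x] at h'
    rw [h', ← hi, ← Equiv.Perm.mul_apply, ← zpow_add]
    congr 2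
    ring
  rcases Int.even_or_odd' i with ⟨m, rfl | rfl⟩
  · have h := hm m
    rw [show 2 * m - m = m by ring] at h
    generalize (R.faceNext ^ m) x = y at h
    exact y.1.symm_ne (congrArg Prod.fst h)
  · have h := hm m
    rw [show 2 * m + 1 - m = 1 + m by ring, zpow_add, Equiv.Perm.mul_apply, zpow_one] at h
    generalize (R.faceNext ^ m) x = y at h
    simp only [faceNext, chiral, Equiv.Perm.mul_apply] at h
    rw [sheetSwap_coverInv, EmbeddingLike.apply_eq_iff_eq] at h
    have h2 : y.2 + 1 = y.2 := congrArg Prod.snd h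
    simp at h2

/-- Two arcs of the double covering graph belong to the same face if they lie on the same facial
walk up to a cyclic shift, or if one lies on the inverse of the facial walk of the other. -/
def faceSetoid : Setoid (CoverArc G) where
  r x y := R.faceNext.SameCycle x y ∨ R.faceNext.SameCycle x (R.chiral y)
  iseqv :=
    { refl := fun x => Or.inl (Equiv.Perm.SameCycle.refl _ x)
      symm := by
        rintro x y (h | h)
        · exact Or.inl h.symm
        · refine Or.inr ?_
          have := R.sameCycle_chiral h.symm
          rwa [chiral_chiral] at this
      trans := by
        rintro x y z (h | h) (h' | h')
        · exact Or.inl (h.trans h')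
        · exact Or.inr (h.trans h')
        · exact Or.inr (h.trans (R.sameCycle_chiral h'))
        · refine Or.inl (h.trans ?_)
          have := R.sameCycle_chiral h'
          rwa [chiral_chiral] at this }

/-- The set `F` of faces: facial walks up to cyclic shift and inversion. -/
def Face : Type _ := Quotient R.faceSetoid

noncomputable instance [Finite G.Dart] : Fintype R.Face :=
  haveI : Finite R.Face := inferInstanceAs (Finite (Quotient R.faceSetoid))
  Fintype.ofFinite _

open scoped Classical in
/-- The arcs of the double covering graph on a facial walk that represents the face `f` (one of
its two orientations is chosen). A facial walk passes through each of them exactly once. -/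
noncomputable def facialWalk [Fintype G.Dart] (f : R.Face) : Finset (CoverArc G) :=
  Finset.univ.filter fun x => R.faceNext.SameCycle (Quotient.out f) x

/-- The length `|f|` of the facial walk of `f`. -/
noncomputable def faceLength [Fintype G.Dart] (f : R.Face) : ℕ := (R.facialWalk f).card

open scoped Classical in
/-- The self-intersections `f ∩ f̄`: the arcs `e` on the facial walk `f` such that `f` also passes
through the inverse arc of `e`. Both `e` and its inverse are elements. -/
noncomputable def selfIntersections [Fintype G.Dart] (f : R.Face) : Finset (CoverArc G) :=
  (R.facialWalk f).filter fun x => R.coverInv x ∈ R.facialWalk f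

/-- If a facial walk passes through lifts of an arc of `G` and of its inverse arc, then these two
lifts are inverse to each other in the double covering graph. -/
lemma mem_selfIntersections_iff [Fintype G.Dart] {f : R.Face} {x : CoverArc G} :
    x ∈ R.selfIntersections f ↔
      x ∈ R.facialWalk f ∧ ∃ y ∈ R.facialWalk f, y.1 = x.1.symm := by
  simp only [selfIntersections, Finset.mem_filter]
  refine and_congr_right fun hx => ⟨fun h => ⟨_, h, rfl⟩, ?_⟩
  rintro ⟨y, hy, hyx⟩
  have hd : ∀ i j : ZMod 2, i = j ∨ i = j + 1 := by decide
  rcases hd y.2 (x.2 + R.twist x.1) with h | h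
  · have : y = R.coverInv x := Prod.ext hyx h
    rwa [← this]
  · have : y = R.chiral x := Prod.ext hyx h
    subst this
    simp only [facialWalk, Finset.mem_filter, Finset.mem_univ, true_and] at hx hy
    exact absurd (hx.symm.trans hy) (R.not_sameCycle_chiral x)

/-- `dist_f(x, y)`: the least number of steps from `y` to `x` along the facial walk that
contains both; if the walk is `(e_0, …, e_{r-1})`, then `dist_f(e_l, e_m)` is `l - m` modulo `r`. -/
noncomputable def faceDist (x y : CoverArc G) : ℕ := sInf {k : ℕ | (R.faceNext ^ k) y = x}

end RotationSystem

/-- The arcs of the blow-up graph with the hedgehog tails. The vertices of the blow-up graph are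
the arcs `v` of the double covering graph. With `ρ` the rotation of the double covering graph and
`v̄` the inverse arc of `v`, each `v` has

* a bridge arc `bridge v` from `v` to `v̄`;
* an island arc from `v` to `ρ v`, divided by a boundary vertex `x_v` into the two quay arcs
  `quayIn v` from `v` to `x_v` and `quayOut v` from `x_v` to `ρ v`;
* a tail, a semi-infinite path with root `x_v`, with arcs `tailIn v n` towards `x_v` and inverse
  arcs `tailOut v n`, where `n` is the distance from `x_v` to the nearer end of the arc. -/
inductive WalkArc (G : SimpleGraph V) : Type _
  | bridge (v : CoverArc G)
  | quayIn (v : CoverArc G)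
  | quayOut (v : CoverArc G)
  | tailIn (v : CoverArc G) (n : ℕ)
  | tailOut (v : CoverArc G) (n : ℕ)

variable (R : RotationSystem G) (C : Matrix (Fin 2) (Fin 2) ℂ)

/-- One step of the time evolution with local coin `C = !![a, b; c, d]`. At each vertex the
amplitudes on the incoming island arc and the incoming bridge (or tail) arc are sent by `C` to
those on the outgoing island arc and the outgoing bridge (or tail) arc, the latter with the sign
`(-1)^τ` on a bridge; the dynamics on the tails is free. -/
def step (ψ : WalkArc G → ℂ) : WalkArc G → ℂ
  | .bridge v =>
      (-1) ^ (R.twist v.1).val *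
        (C 1 0 * ψ (.quayOut (R.coverRot⁻¹ v)) + C 1 1 * ψ (.bridge (R.coverInv v)))
  | .quayIn v => C 0 0 * ψ (.quayOut (R.coverRot⁻¹ v)) + C 0 1 * ψ (.bridge (R.coverInv v))
  | .quayOut v => C 0 0 * ψ (.quayIn v) + C 0 1 * ψ (.tailIn v 0)
  | .tailOut v 0 => C 1 0 * ψ (.quayIn v) + C 1 1 * ψ (.tailIn v 0)
  | .tailOut v (n + 1) => ψ (.tailOut v n)
  | .tailIn v n => ψ (.tailIn v (n + 1))

/-- The initial state with inflow `α`: the constant `α v` on all the arcs of the tail at `x_v` that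
point to the interior, and `0` elsewhere. -/
def initialState (α : CoverArc G → ℂ) : WalkArc G → ℂ
  | .tailIn v _ => α v
  | _ => 0

/-- The state at time `t` of the walk with inflow `α`. -/
def walk (α : CoverArc G → ℂ) (t : ℕ) : WalkArc G → ℂ := (step R C)^[t] (initialState α)

/-- The stationary state: the pointwise limit of the walk as the time tends to infinity. -/
noncomputable def stationaryState (α : CoverArc G → ℂ) (x : WalkArc G) : ℂ :=
  limUnder atTop fun t : ℕ => walk R C α t x

/-- The comfortability: half of the squared norm of the stationary state restricted to the
internal graph, that is, to the bridge arcs and the quay arcs. -/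
noncomputable def comfortability [Fintype G.Dart] (α : CoverArc G → ℂ) : ℝ :=
  (1 / 2) * ∑ v : CoverArc G, (‖stationaryState R C α (.bridge v)‖ ^ 2 +
    ‖stationaryState R C α (.quayIn v)‖ ^ 2 + ‖stationaryState R C α (.quayOut v)‖ ^ 2)

open scoped Classical in
/-- The average of the comfortability over the inflows `δ_v` into a single tail, the tail being
chosen uniformly at random. -/
noncomputable def meanComfortability [Fintype G.Dart] : ℝ :=
  (1 / (Fintype.card (CoverArc G) : ℝ)) *
    ∑ v : CoverArc G, comfortability R C (Pi.single v 1)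

end EmbeddedWalk

/-! Unitarity, determinant -1 and real `a` force the coin to be `!![a, b; conj b, -a]`. For this
coin a fixed state of the walk can be written down explicitly. Multiplication by the sign of the
sheet absorbs the signs `(-1)^τ` on the bridges, and the amplitudes then decouple along facial
walks: from one arc of a walk to the next, the flow is multiplied by `a` and receives the local
inflow (`faceFlow_faceNext`, `step_equilibrium`). The initial state differs from this fixed state by
one without inflow, whose internal energy leaks into the tails. The walk therefore converges to the
fixed state (`tendsto_walk_of_step_eq`).

The response to a unit inflow is, up to signs and the coin, a column of the kernel `K = (1 - A)⁻¹`,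
where `A` is `a` times the permutation matrix of the facial step. Averaging over the tails turns
energies into entries of `K Kᵀ`, and `A Aᵀ = a²` gives `(1 - a²) K Kᵀ = K + Kᵀ - 1`
(`cycleKernel_mul_transpose`). Diagonal entries yield the face lengths. The cross terms of the
bridges are the entries at `(v̄, v)`, which vanish unless a walk passes through both arcs. Each face
consists of two disjoint, mutually inverse walks with equal contributions
(`sum_eq_two_mul_sum_facialWalk`). -/

namespace EmbeddedWalk

/-! ### The damped Green kernel of a permutation. -/

section CycleKernel

variable {ι : Type*}

/-- The least number of steps of `σ` from `y` to `x`. -/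
noncomputable def cycleDist (σ : Equiv.Perm ι) (x y : ι) : ℕ := sInf {k : ℕ | (σ ^ k) y = x}

lemma sameCycle_of_conj_eq_inv {σ π : Equiv.Perm ι} (h : π * σ * π⁻¹ = σ⁻¹) (x y : ι) :
    σ.SameCycle (π x) (π y) ↔ σ.SameCycle x y := by
  rw [← Equiv.Perm.sameCycle_inv, ← h, Equiv.Perm.sameCycle_conj]
  simp

variable [Fintype ι]

open scoped Classical in
/-- The length of the cycle of `σ` through `x`. -/
noncomputable def cycleLength (σ : Equiv.Perm ι) (x : ι) : ℕ :=
  (Finset.univ.filter fun y => σ.SameCycle x y).card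

variable (σ : Equiv.Perm ι) (a : ℝ)

lemma isCycleOn_filter_sameCycle (x : ι) [DecidablePred (σ.SameCycle x)] :
    σ.IsCycleOn (Finset.univ.filter fun y => σ.SameCycle x y : Finset ι) := by
  have hx : ∀ y, σ.SameCycle x (σ y) ↔ σ.SameCycle x y := fun y =>
    Equiv.Perm.sameCycle_apply_right
  refine ⟨⟨fun y hy => ?_, σ.injective.injOn, fun y hy => ⟨σ⁻¹ y, ?_, by simp⟩⟩, fun y hy z hz => ?_⟩
  · simpa using hy
  · simpa using hy
  · simp only [Finset.coe_filter, Finset.mem_univ, true_and, Set.mem_ofPred_eq] at hy hz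
    exact hy.symm.trans hz

lemma cycleLength_pos (x : ι) : 0 < cycleLength σ x := by
  classical
  exact Finset.card_pos.2 ⟨x, by simp [Equiv.Perm.SameCycle.refl]⟩

lemma cycleLength_congr {x y : ι} (h : σ.SameCycle x y) : cycleLength σ x = cycleLength σ y := by
  classical
  unfold cycleLength
  congr 1
  ext z
  simp only [Finset.mem_filter, Finset.mem_univ, true_and]
  exact ⟨h.symm.trans, h.trans⟩

lemma pow_apply_eq_pow_apply_iff (x : ι) {m n : ℕ} :
    (σ ^ m) x = (σ ^ n) x ↔ m ≡ n [MOD cycleLength σ x] := by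
  classical
  exact (isCycleOn_filter_sameCycle σ x).pow_apply_eq_pow_apply
    (by simp [Equiv.Perm.SameCycle.refl])

lemma cycleDist_spec {x y : ι} (h : σ.SameCycle y x) : (σ ^ cycleDist σ x y) y = x := by
  classical
  obtain ⟨n, -, hn⟩ := (isCycleOn_filter_sameCycle σ y).exists_pow_eq (a := y) (b := x)
    (by simp [Equiv.Perm.SameCycle.refl]) (by simpa using h)
  exact Nat.sInf_mem (s := {k : ℕ | (σ ^ k) y = x}) ⟨n, hn⟩

lemma cycleDist_lt {x y : ι} (h : σ.SameCycle y x) : cycleDist σ x y < cycleLength σ y := by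
  classical
  obtain ⟨n, hlt, hn⟩ := (isCycleOn_filter_sameCycle σ y).exists_pow_eq (a := y) (b := x)
    (by simp [Equiv.Perm.SameCycle.refl]) (by simpa using h)
  exact (Nat.sInf_le (s := {k : ℕ | (σ ^ k) y = x}) hn).trans_lt hlt

lemma cycleDist_eq {x y : ι} {k : ℕ} (hk : k < cycleLength σ y) (h : (σ ^ k) y = x) :
    cycleDist σ x y = k := by
  have hs : σ.SameCycle y x := ⟨k, by simpa using h⟩
  have := (pow_apply_eq_pow_apply_iff σ y).1 ((cycleDist_spec σ hs).trans h.symm)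
  exact Nat.ModEq.eq_of_lt_of_lt this (cycleDist_lt σ hs) hk

lemma cycleDist_self (x : ι) : cycleDist σ x x = 0 :=
  cycleDist_eq σ (cycleLength_pos σ x) rfl

lemma cycleDist_apply {x y : ι} (h : σ.SameCycle y x) (hne : σ x ≠ y) :
    cycleDist σ (σ x) y = cycleDist σ x y + 1 := by
  have hx := cycleDist_spec σ h
  have hs : (σ ^ (cycleDist σ x y + 1)) y = σ x := by rw [pow_succ', Equiv.Perm.mul_apply, hx]
  refine cycleDist_eq σ (lt_of_le_of_ne (cycleDist_lt σ h) fun he => hne ?_) hs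
  rw [← hs, he]
  exact (pow_apply_eq_pow_apply_iff σ y (n := 0)).2 (by simp [Nat.ModEq])

lemma cycleDist_apply_self (x : ι) : cycleDist σ x (σ x) + 1 = cycleLength σ x := by
  have h : σ.SameCycle (σ x) x := (Equiv.Perm.sameCycle_apply_left).2 (Equiv.Perm.SameCycle.refl _ _)
  have hlen : cycleLength σ (σ x) = cycleLength σ x := cycleLength_congr σ h
  have hlt := cycleDist_lt σ h
  have hx : (σ ^ (cycleDist σ x (σ x) + 1)) x = (σ ^ 0) x := by
    rw [pow_succ, Equiv.Perm.mul_apply, cycleDist_spec σ h, pow_zero, Equiv.Perm.one_apply]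
  have hd := (Nat.modEq_zero_iff_dvd).1 ((pow_apply_eq_pow_apply_iff σ x).1 hx)
  exact le_antisymm (by omega) (Nat.le_of_dvd (Nat.succ_pos _) hd)

open scoped Classical in
/-- The sum of `a ^ k` over the `k` with `(σ ^ k) y = x`, in closed form. -/
noncomputable def cycleKernel : Matrix ι ι ℝ := Matrix.of fun x y =>
  if σ.SameCycle y x then a ^ cycleDist σ x y / (1 - a ^ cycleLength σ y) else 0

variable {a}

lemma one_sub_pow_cycleLength_ne_zero (ha0 : 0 ≤ a) (ha1 : a < 1) (x : ι) :
    1 - a ^ cycleLength σ x ≠ 0 :=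
  (sub_pos.2 (pow_lt_one₀ ha0 ha1 (cycleLength_pos σ x).ne')).ne'

lemma cycleKernel_self (x : ι) : cycleKernel σ a x x = 1 / (1 - a ^ cycleLength σ x) := by
  simp [cycleKernel, cycleDist_self, Equiv.Perm.SameCycle.refl]

lemma cycleKernel_of_sameCycle {x y : ι} (h : σ.SameCycle y x) :
    cycleKernel σ a x y = a ^ cycleDist σ x y / (1 - a ^ cycleLength σ y) := by
  simp [cycleKernel, h]

lemma cycleKernel_of_not_sameCycle {x y : ι} (h : ¬ σ.SameCycle y x) :
    cycleKernel σ a x y = 0 := by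
  simp [cycleKernel, h]

/-- Every path of positive length from `y` to `σ x` passes through `x` just before its end; the
empty path, present when `σ x = y`, contributes the 1. In matrix form this is `(1 - A) K = 1`. -/
lemma cycleKernel_apply_left [DecidableEq ι] (ha0 : 0 ≤ a) (ha1 : a < 1) (x y : ι) :
    cycleKernel σ a (σ x) y = a * cycleKernel σ a x y + if σ x = y then 1 else 0 := by
  by_cases h : σ.SameCycle y x
  · have h' : σ.SameCycle y (σ x) := Equiv.Perm.sameCycle_apply_right.2 h
    rw [cycleKernel_of_sameCycle σ h, cycleKernel_of_sameCycle σ h']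
    have hne := one_sub_pow_cycleLength_ne_zero σ ha0 ha1 y
    split_ifs with hxy
    · subst hxy
      rw [cycleDist_self, cycleLength_congr σ h] at *
      -- The cycle closes here: with `r` its length, the distance falls from `r - 1` to 0, and `a *
      -- a ^ (r - 1) / (1 - a ^ r) + 1 = 1 / (1 - a ^ r)`.
      have := congrArg (a ^ ·) (cycleDist_apply_self σ x)
      simp only [pow_succ'] at this
      field_simp
      rw [this]
      ring
    · rw [cycleDist_apply σ h hxy]
      ring
  · have h' : ¬ σ.SameCycle y (σ x) := by rwa [Equiv.Perm.sameCycle_apply_right]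
    have hxy : σ x ≠ y := by
      rintro rfl
      exact h' (Equiv.Perm.SameCycle.refl _ _)
    simp [cycleKernel_of_not_sameCycle σ h, cycleKernel_of_not_sameCycle σ h', hxy]

/-- Multiplying `K + Kᵀ - 1` by `1 - A` on the left and `1 - Aᵀ` on the right leaves `1 - A Aᵀ`, a
scalar matrix because `A` is `a` times a permutation matrix. Undoing both factors gives the
identity. -/
lemma cycleKernel_mul_transpose [DecidableEq ι] (ha0 : 0 ≤ a) (ha1 : a < 1) :
    (1 - a ^ 2) • (cycleKernel σ a * (cycleKernel σ a).transpose) =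
      cycleKernel σ a + (cycleKernel σ a).transpose - 1 := by
  set K := cycleKernel σ a
  set A : Matrix ι ι ℝ := Matrix.of fun x y => if σ.symm x = y then a else 0
  have hAA : A * A.transpose = a ^ 2 • (1 : Matrix ι ι ℝ) := by
    ext x y
    by_cases h : x = y <;> simp [A, Matrix.mul_apply, h, pow_two, eq_comm]
  have hMK : (1 - A) * K = 1 := by
    ext x y
    have h := cycleKernel_apply_left σ ha0 ha1 (σ.symm x) y
    rw [Equiv.apply_symm_apply] at h
    rw [sub_mul, one_mul, Matrix.sub_apply, Matrix.one_apply, sub_eq_iff_eq_add, add_comm]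
    simpa [A, Matrix.mul_apply] using h
  have hKM : K * (1 - A) = 1 := mul_eq_one_comm.1 hMK
  have hMKT : K.transpose * (1 - A.transpose) = 1 := by
    simpa using congrArg Matrix.transpose hMK
  have hKMT : (1 - A.transpose) * K.transpose = 1 := by
    simpa using congrArg Matrix.transpose hKM
  have hcore : (1 - A) * (K + K.transpose - 1) * (1 - A.transpose) =
      (1 - a ^ 2) • (1 : Matrix ι ι ℝ) := by
    calc _ = (1 - A) * K * (1 - A.transpose) + (1 - A) * (K.transpose * (1 - A.transpose)) -
          (1 - A) * (1 - A.transpose) := by noncomm_ring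
      _ = 1 - A * A.transpose := by
        rw [hMK, hMKT]
        noncomm_ring
      _ = _ := by rw [hAA, sub_smul, one_smul]
  calc _ = K * ((1 - a ^ 2) • (1 : Matrix ι ι ℝ)) * K.transpose := by simp
    _ = (K * (1 - A)) * (K + K.transpose - 1) * ((1 - A.transpose) * K.transpose) := by
      rw [← hcore]; simp only [mul_assoc]
    _ = _ := by rw [hKM, hKMT, one_mul, mul_one]

lemma sum_cycleKernel_mul_cycleKernel [DecidableEq ι] (ha0 : 0 ≤ a) (ha1 : a < 1) (x y : ι) :
    (1 - a ^ 2) * ∑ u, cycleKernel σ a x u * cycleKernel σ a y u =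
      cycleKernel σ a x y + cycleKernel σ a y x - if x = y then 1 else 0 := by
  have := congrFun (congrFun (cycleKernel_mul_transpose σ ha0 ha1) x) y
  simpa [Matrix.mul_apply, Matrix.one_apply] using this

lemma sum_cycleKernel_sq (ha0 : 0 ≤ a) (ha1 : a < 1) (x : ι) :
    (1 - a ^ 2) * ∑ u, cycleKernel σ a x u ^ 2 =
      (1 + a ^ cycleLength σ x) / (1 - a ^ cycleLength σ x) := by
  classical
  have hne := one_sub_pow_cycleLength_ne_zero σ ha0 ha1 x
  simp only [pow_two (cycleKernel σ a x _)]
  rw [sum_cycleKernel_mul_cycleKernel σ ha0 ha1, cycleKernel_self, if_pos rfl]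
  field_simp
  ring

lemma cycleKernel_apply_apply (x y : ι) : cycleKernel σ a (σ x) (σ y) = cycleKernel σ a x y := by
  have hl : cycleLength σ (σ y) = cycleLength σ y :=
    cycleLength_congr σ (Equiv.Perm.sameCycle_apply_left.2 (Equiv.Perm.SameCycle.refl _ _))
  have hd : cycleDist σ (σ x) (σ y) = cycleDist σ x y := by
    unfold cycleDist
    congr 1
    ext k
    rw [Set.mem_ofPred_eq, Set.mem_ofPred_eq, ← Equiv.Perm.mul_apply, ← pow_succ, pow_succ',
      Equiv.Perm.mul_apply, EmbeddingLike.apply_eq_iff_eq]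
  have hs : σ.SameCycle (σ y) (σ x) ↔ σ.SameCycle y x :=
    Equiv.Perm.sameCycle_apply_left.trans Equiv.Perm.sameCycle_apply_right
  by_cases h : σ.SameCycle y x
  · rw [cycleKernel_of_sameCycle σ h, cycleKernel_of_sameCycle σ (hs.2 h), hd, hl]
  · rw [cycleKernel_of_not_sameCycle σ h, cycleKernel_of_not_sameCycle σ (h ∘ hs.1)]

variable {σ} in
lemma cycleLength_of_conj_eq_inv {π : Equiv.Perm ι} (h : π * σ * π⁻¹ = σ⁻¹) (x : ι) :
    cycleLength σ (π x) = cycleLength σ x := by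
  classical
  unfold cycleLength
  refine (Finset.card_equiv π fun z => ?_).symm
  simp [sameCycle_of_conj_eq_inv h]

-- Conjugation by `π` reverses the cycles, so `k` steps from `x` to `y` become `k` steps from `π y`
-- to `π x`. It is applied to `chiral`, which inverts facial walks.
variable {σ} in
lemma cycleKernel_of_conj_eq_inv {π : Equiv.Perm ι} (h : π * σ * π⁻¹ = σ⁻¹) (x y : ι) :
    cycleKernel σ a (π x) (π y) = cycleKernel σ a y x := by
  have hs := sameCycle_of_conj_eq_inv h
  have hpow (k : ℕ) (x : ι) : (σ ^ k) (π ((σ ^ k) x)) = π x := by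
    have : π * σ ^ k * π⁻¹ = (σ ^ k)⁻¹ := by rw [← conj_pow, h, inv_pow]
    have h' := congrArg (fun p : Equiv.Perm ι => p (π x)) this
    simp only [Equiv.Perm.mul_apply] at h'
    rw [show π⁻¹ (π x) = x from π.symm_apply_apply x] at h'
    rw [h']
    exact (σ ^ k).apply_symm_apply _
  have hd : cycleDist σ (π x) (π y) = cycleDist σ y x := by
    unfold cycleDist
    congr 1
    ext k
    rw [Set.mem_ofPred_eq, Set.mem_ofPred_eq]
    constructor
    · intro hk
      rw [← hpow k x, EmbeddingLike.apply_eq_iff_eq, EmbeddingLike.apply_eq_iff_eq] at hk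
      exact hk.symm
    · rintro rfl
      exact hpow k x
  by_cases hc : σ.SameCycle y x
  · rw [cycleKernel_of_sameCycle σ ((hs y x).2 hc), cycleKernel_of_sameCycle σ hc.symm, hd,
      cycleLength_of_conj_eq_inv h, cycleLength_congr σ hc]
  · rw [cycleKernel_of_not_sameCycle σ fun h' => hc ((hs y x).1 h'),
      cycleKernel_of_not_sameCycle σ fun h' => hc h'.symm]

end CycleKernel

/-! ### Consequences of unitarity for the coin. -/

section Coin

variable {C : Matrix (Fin 2) (Fin 2) ℂ}

lemma coin_norm_sq (hC : C ∈ Matrix.unitaryGroup (Fin 2) ℂ) (x y : ℂ) :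
    ‖C 0 0 * x + C 0 1 * y‖ ^ 2 + ‖C 1 0 * x + C 1 1 * y‖ ^ 2 = ‖x‖ ^ 2 + ‖y‖ ^ 2 := by
  have h := Matrix.mem_unitaryGroup_iff'.1 hC
  have h00 := congrFun (congrFun h 0) 0
  have h01 := congrFun (congrFun h 0) 1
  have h10 := congrFun (congrFun h 1) 0
  have h11 := congrFun (congrFun h 1) 1
  simp [Matrix.mul_apply, Fin.sum_univ_two, Matrix.star_apply] at h00 h01 h10 h11
  apply Complex.ofReal_injective
  push_cast
  simp only [← Complex.conj_mul', map_add, map_mul]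
  linear_combination (starRingEnd ℂ x * x) * h00 + (starRingEnd ℂ x * y) * h01 +
    (starRingEnd ℂ y * x) * h10 + (starRingEnd ℂ y * y) * h11

lemma coin_norm_sq_row (hC : C ∈ Matrix.unitaryGroup (Fin 2) ℂ) :
    ‖C 0 0‖ ^ 2 + ‖C 0 1‖ ^ 2 = 1 := by
  have h00 := congrFun (congrFun (Matrix.mem_unitaryGroup_iff.1 hC) 0) 0
  simp [Matrix.mul_apply, Fin.sum_univ_two, Matrix.star_apply] at h00
  apply Complex.ofReal_injective
  push_cast
  simpa only [← Complex.mul_conj'] using h00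

/-- A unitary matrix of determinant `-1` with a nonzero real entry in the upper left corner. -/
lemma coin_eq_of_det_eq_neg_one (hC : C ∈ Matrix.unitaryGroup (Fin 2) ℂ) (hdet : C.det = -1)
    {a : ℝ} (ha : a ≠ 0) (haC : C 0 0 = (a : ℂ)) :
    C 1 1 = -(a : ℂ) ∧ C 1 0 = starRingEnd ℂ (C 0 1) := by
  have h := Matrix.mem_unitaryGroup_iff.1 hC
  have h00 := congrFun (congrFun h 0) 0
  have h10 := congrFun (congrFun h 1) 0
  simp [Matrix.mul_apply, Fin.sum_univ_two, Matrix.star_apply, haC] at h00 h10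
  rw [Matrix.det_fin_two, haC] at hdet
  have hd : C 1 1 = -(a : ℂ) := by
    -- Adding `b` times the orthogonality of the rows to `a` times the determinant eliminates `c`;
    -- the norm of the first row then leaves `d = -a`.
    linear_combination (a : ℂ) * hdet + C 0 1 * h10 - C 1 1 * h00
  refine ⟨hd, ?_⟩
  rw [hd] at h10
  have ha' : (a : ℂ) ≠ 0 := by exact_mod_cast ha
  apply mul_right_cancel₀ ha'
  linear_combination h10

end Coin

/-! ### Loss of energy into the tails and convergence. -/

section Decay

variable {V : Type*} {G : SimpleGraph V} (R : RotationSystem G) {C : Matrix (Fin 2) (Fin 2) ℂ}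

lemma step_sub (ψ φ : WalkArc G → ℂ) : step R C (ψ - φ) = step R C ψ - step R C φ := by
  funext x
  rcases x with v | v | v | ⟨v, n⟩ | ⟨v, _ | n⟩ <;> simp only [step, Pi.sub_apply] <;> ring

lemma step_iterate_sub (ψ φ : WalkArc G → ℂ) (t : ℕ) :
    (step R C)^[t] (ψ - φ) = (step R C)^[t] ψ - (step R C)^[t] φ := by
  induction t generalizing ψ φ with
  | zero => rfl
  | succ t ih => rw [Function.iterate_succ_apply, step_sub, ih]; rfl

/-- The squared norm of a state on the internal graph. -/
noncomputable def energy [Fintype G.Dart] (ψ : WalkArc G → ℂ) : ℝ :=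
  ∑ v : CoverArc G, (‖ψ (.bridge v)‖ ^ 2 + ‖ψ (.quayIn v)‖ ^ 2 + ‖ψ (.quayOut v)‖ ^ 2)

/-- Scattering between islands and bridges is unitary, so energy is lost only at the boundary
vertices, where the fraction `|a|² = 1 - |b|²` stays inside. -/
lemma energy_step [Fintype G.Dart] (hC : C ∈ Matrix.unitaryGroup (Fin 2) ℂ) (ψ : WalkArc G → ℂ)
    (hψ : ∀ v, ψ (.tailIn v 0) = 0) :
    energy (step R C ψ) = energy ψ - ‖C 0 1‖ ^ 2 * ∑ v, ‖ψ (.quayIn v)‖ ^ 2 := by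
  have hrow := coin_norm_sq_row hC
  have h1 (v : CoverArc G) : ‖step R C ψ (.bridge v)‖ ^ 2 + ‖step R C ψ (.quayIn v)‖ ^ 2 +
      ‖step R C ψ (.quayOut v)‖ ^ 2 = ‖ψ (.quayOut (R.coverRot⁻¹ v))‖ ^ 2 +
        ‖ψ (.bridge (R.coverInv v))‖ ^ 2 + ‖C 0 0‖ ^ 2 * ‖ψ (.quayIn v)‖ ^ 2 := by
    simp only [step, hψ, mul_zero, add_zero, norm_mul, norm_pow, norm_neg, norm_one, one_pow,
      one_mul]
    linear_combination coin_norm_sq hC (ψ (.quayOut (R.coverRot⁻¹ v))) (ψ (.bridge (R.coverInv v)))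
  simp only [energy, h1, Finset.sum_add_distrib, ← Finset.mul_sum]
  rw [Equiv.sum_comp R.coverRot⁻¹ fun v => ‖ψ (.quayOut v)‖ ^ 2,
    Equiv.sum_comp R.coverInv fun v => ‖ψ (.bridge v)‖ ^ 2]
  linear_combination (∑ v, ‖ψ (.quayIn v)‖ ^ 2) * hrow

/-- Without inflow the walk leaves every finite part of the graph. -/
lemma tendsto_step_iterate_zero [Finite G.Dart] (hC : C ∈ Matrix.unitaryGroup (Fin 2) ℂ)
    (hb : C 0 1 ≠ 0) (ψ : WalkArc G → ℂ) (hψ : ∀ v n, ψ (.tailIn v n) = 0) (x : WalkArc G) :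
    Tendsto (fun t => (step R C)^[t] ψ x) atTop (𝓝 0) := by
  cases nonempty_fintype G.Dart
  have htail (t : ℕ) (v : CoverArc G) (n : ℕ) : (step R C)^[t] ψ (.tailIn v n) = 0 := by
    induction t generalizing n with
    | zero => exact hψ v n
    | succ t ih => rw [Function.iterate_succ_apply']; exact ih (n + 1)
  set E : ℕ → ℝ := fun t => energy ((step R C)^[t] ψ)
  have hE (t : ℕ) : E (t + 1) =
      E t - ‖C 0 1‖ ^ 2 * ∑ v, ‖(step R C)^[t] ψ (.quayIn v)‖ ^ 2 := by
    simp only [E, Function.iterate_succ_apply']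
    exact energy_step R hC _ fun v => htail t v 0
  have hanti : Antitone E := antitone_nat_of_succ_le fun t => by
    rw [hE]
    exact sub_le_self _ (by positivity)
  have hbdd : BddBelow (Set.range E) := by
    refine ⟨0, ?_⟩
    rintro _ ⟨t, rfl⟩
    simp only [E, energy]
    positivity
  have hlim := tendsto_atTop_ciInf hanti hbdd
  have hin (v : CoverArc G) :
      Tendsto (fun t => (step R C)^[t] ψ (.quayIn v)) atTop (𝓝 0) := by
    have hb' : 0 < ‖C 0 1‖ ^ 2 := by positivity
    -- The energy converges, so its decrements tend to 0, and they control every `quayIn` amplitude.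
    have h0 : Tendsto (fun t => (E t - E (t + 1)) / ‖C 0 1‖ ^ 2) atTop (𝓝 0) := by
      simpa using (hlim.sub (hlim.comp (tendsto_add_atTop_nat 1))).div_const (‖C 0 1‖ ^ 2)
    have hsq : Tendsto (fun t => ‖(step R C)^[t] ψ (.quayIn v)‖ ^ 2) atTop (𝓝 0) := by
      refine squeeze_zero (fun t => by positivity) (fun t => ?_) h0
      rw [hE, sub_sub_cancel, mul_div_cancel_left₀ _ hb'.ne']
      exact Finset.single_le_sum (f := fun v => ‖(step R C)^[t] ψ (.quayIn v)‖ ^ 2)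
        (fun v _ => by positivity) (Finset.mem_univ v)
    rw [tendsto_zero_iff_norm_tendsto_zero]
    simpa using hsq.sqrt
  have hout (v : CoverArc G) :
      Tendsto (fun t => (step R C)^[t] ψ (.quayOut v)) atTop (𝓝 0) := by
    rw [← tendsto_add_atTop_iff_nat 1]
    simp only [Function.iterate_succ_apply', step, htail, mul_zero, add_zero]
    simpa using (hin v).const_mul (C 0 0)
  have hbridge (v : CoverArc G) :
      Tendsto (fun t => (step R C)^[t] ψ (.bridge v)) atTop (𝓝 0) := by
    -- The update rule for `quayIn` at `v̄` is solved for the amplitude on `bridge v`, which is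
    -- possible since `b ≠ 0`.
    have h1 := (((hin (R.coverInv v)).comp (tendsto_add_atTop_nat 1)).sub
      ((hout (R.coverRot⁻¹ (R.coverInv v))).const_mul (C 0 0))).const_mul (C 0 1)⁻¹
    simp only [mul_zero, sub_zero] at h1
    refine h1.congr fun t => ?_
    simp only [Function.comp_apply, Function.iterate_succ_apply', step, R.coverInv_coverInv]
    field_simp
    ring
  rcases x with v | v | v | ⟨v, n⟩ | ⟨v, n⟩
  · exact hbridge v
  · exact hin v
  · exact hout v
  · simp [htail]
  · induction n with
    | zero =>
      rw [← tendsto_add_atTop_iff_nat 1]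
      simp only [Function.iterate_succ_apply', step, htail, mul_zero, add_zero]
      simpa using (hin v).const_mul (C 1 0)
    | succ n ih =>
      rw [← tendsto_add_atTop_iff_nat 1]
      simpa only [Function.iterate_succ_apply', step] using ih

lemma tendsto_walk_of_step_eq [Finite G.Dart] (hC : C ∈ Matrix.unitaryGroup (Fin 2) ℂ)
    (hb : C 0 1 ≠ 0) {α : CoverArc G → ℂ} {φ : WalkArc G → ℂ} (hφ : step R C φ = φ)
    (hα : ∀ v n, φ (.tailIn v n) = α v) (x : WalkArc G) :
    Tendsto (fun t => walk R C α t x) atTop (𝓝 (φ x)) := by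
  have h := tendsto_step_iterate_zero R hC hb (initialState α - φ)
    (fun v n => by simp [initialState, hα]) x
  simp only [step_iterate_sub, Function.iterate_fixed hφ, Pi.sub_apply] at h
  simpa [walk] using h.add_const (φ x)

end Decay

/-! ### The explicit stationary state and its total energy. -/

section Stationary

variable {V : Type*} {G : SimpleGraph V} (R : RotationSystem G) {C : Matrix (Fin 2) (Fin 2) ℂ}

lemma neg_one_pow_val_add (i j : ZMod 2) :
    (-1 : ℂ) ^ (i + j).val = (-1) ^ i.val * (-1) ^ j.val := by
  rw [ZMod.val_add, ← pow_add]
  exact (neg_one_pow_eq_pow_mod_two _).symm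

lemma neg_one_pow_mul_self (n : ℕ) : (-1 : ℂ) ^ n * (-1) ^ n = 1 := by
  rw [← mul_pow]; simp

/-- The sign of the sheet on which the terminus of an arc lies. -/
noncomputable def sheetSign (v : CoverArc G) : ℂ := (-1) ^ v.2.val

/-- The sign of the twist of an arc. -/
noncomputable def twistSign (v : CoverArc G) : ℂ := (-1) ^ (R.twist v.1).val

lemma sheetSign_mul_self (v : CoverArc G) : sheetSign v * sheetSign v = 1 :=
  neg_one_pow_mul_self _

lemma norm_sheetSign (v : CoverArc G) : ‖sheetSign v‖ = 1 := by simp [sheetSign]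

lemma twistSign_mul_self (v : CoverArc G) : twistSign R v * twistSign R v = 1 :=
  neg_one_pow_mul_self _

lemma norm_twistSign (v : CoverArc G) : ‖twistSign R v‖ = 1 := by simp [twistSign]

lemma twistSign_coverInv (v : CoverArc G) : twistSign R (R.coverInv v) = twistSign R v := by
  simp [twistSign, RotationSystem.coverInv, R.twist_symm]

/-- The twist sign is the quotient of the sheet signs at the two ends of an arc, which is why the
factor `sheetSign` gauges it away. -/
lemma sheetSign_coverInv (v : CoverArc G) :
    sheetSign (R.coverInv v) = sheetSign v * twistSign R v :=
  neg_one_pow_val_add _ _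

lemma sheetSign_coverRot_inv (v : CoverArc G) : sheetSign (R.coverRot⁻¹ v) = sheetSign v := rfl

lemma faceNext_inv_apply (v : CoverArc G) : R.faceNext⁻¹ v = R.coverRot⁻¹ (R.coverInv v) := rfl

lemma faceNext_coverRot_inv (v : CoverArc G) : R.faceNext (R.coverRot⁻¹ v) = R.coverInv v := by
  simp [RotationSystem.faceNext]

lemma coverInv_ne (v : CoverArc G) : R.coverInv v ≠ v := fun h =>
  v.1.symm_ne (congrArg Prod.fst h)

lemma chiral_coverInv (v : CoverArc G) : R.chiral (R.coverInv v) = R.coverInv (R.chiral v) := by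
  simp only [RotationSystem.chiral, Equiv.Perm.mul_apply, R.sheetSwap_coverInv]

variable [Fintype G.Dart] (a : ℝ) (α : CoverArc G → ℂ)

/-- The amplitudes that `α`, damped by `a` at each step, leaves along the facial walks. -/
noncomputable def faceFlow (v : CoverArc G) : ℂ :=
  ∑ u, (cycleKernel R.faceNext a v u : ℂ) * (sheetSign u * α u)

lemma faceFlow_faceNext {a : ℝ} (ha0 : 0 ≤ a) (ha1 : a < 1) (v : CoverArc G) :
    faceFlow R a α (R.faceNext v) =
      a * faceFlow R a α v + sheetSign (R.faceNext v) * α (R.faceNext v) := by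
  classical
  simp only [faceFlow, cycleKernel_apply_left R.faceNext ha0 ha1, Complex.ofReal_add,
    Complex.ofReal_mul, add_mul, Finset.sum_add_distrib, Finset.mul_sum, mul_assoc]
  simp [apply_ite Complex.ofReal]

variable (C)

/-- The stationary state with inflow `α`, for the coin `!![a, b; conj b, -a]`. -/
noncomputable def equilibrium : WalkArc G → ℂ
  | .bridge v => sheetSign v * twistSign R v *
      (faceFlow R a α (R.coverRot⁻¹ v) - a * faceFlow R a α (R.coverRot⁻¹ (R.coverInv v)))
  | .quayIn v => C 0 1 * sheetSign v * faceFlow R a α (R.coverRot⁻¹ (R.coverInv v))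
  | .quayOut v => C 0 1 * sheetSign v * faceFlow R a α v
  | .tailIn v _ => α v
  | .tailOut v _ => C 1 0 * (C 0 1 * sheetSign v *
      faceFlow R a α (R.coverRot⁻¹ (R.coverInv v))) + C 1 1 * α v

variable {C a}

lemma step_equilibrium (hC : C ∈ Matrix.unitaryGroup (Fin 2) ℂ) (hdet : C.det = -1)
    (ha0 : 0 < a) (ha1 : a < 1) (haC : C 0 0 = (a : ℂ)) :
    step R C (equilibrium R C a α) = equilibrium R C a α := by
  obtain ⟨h11, h10⟩ := coin_eq_of_det_eq_neg_one hC hdet ha0.ne' haC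
  have hrow : (a : ℂ) * a + C 0 1 * starRingEnd ℂ (C 0 1) = 1 := by
    have h := congrArg Complex.ofReal (coin_norm_sq_row hC)
    rw [haC, Complex.norm_real, Real.norm_eq_abs, sq_abs] at h
    push_cast at h
    rw [← Complex.mul_conj', pow_two] at h
    exact h
  funext x
  rcases x with v | v | v | ⟨v, n⟩ | ⟨v, _ | n⟩
  · change twistSign R v * _ = _
    simp only [equilibrium, h10, h11, twistSign_coverInv, sheetSign_coverInv,
      sheetSign_coverRot_inv, R.coverInv_coverInv]
    have hs := twistSign_mul_self R v
    -- The relation `hrow` replaces `c * b` by `1 - a²`.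
    linear_combination (sheetSign v * twistSign R v * faceFlow R a α (R.coverRot⁻¹ v)) * hrow -
      a * (sheetSign v * twistSign R v) * (faceFlow R a α (R.coverRot⁻¹ (R.coverInv v)) -
        a * faceFlow R a α (R.coverRot⁻¹ v)) * hs
  · simp only [step, equilibrium, haC, twistSign_coverInv, sheetSign_coverInv,
      sheetSign_coverRot_inv, R.coverInv_coverInv]
    have hs := twistSign_mul_self R v
    linear_combination C 0 1 * sheetSign v * (faceFlow R a α (R.coverRot⁻¹ (R.coverInv v)) -
        a * faceFlow R a α (R.coverRot⁻¹ v)) * hs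
  -- `ρ⁻¹ v̄` is the predecessor of `v` on its facial walk, so passing `x_v` is one step of the flow
  -- recursion.
  · have h := faceFlow_faceNext R α ha0.le ha1 (R.coverRot⁻¹ (R.coverInv v))
    rw [faceNext_coverRot_inv, R.coverInv_coverInv] at h
    simp only [step, equilibrium, haC, h]
    linear_combination -C 0 1 * α v * sheetSign_mul_self v
  · rfl
  · rfl
  · rfl

lemma faceFlow_single [DecidableEq (CoverArc G)] (u v : CoverArc G) :
    faceFlow R a (Pi.single u 1) v = cycleKernel R.faceNext a v u * sheetSign u := by
  simp [faceFlow, Pi.single_apply]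

lemma energy_equilibrium_single [DecidableEq (CoverArc G)] (u : CoverArc G) :
    energy (equilibrium R C a (Pi.single u 1)) = ∑ v,
      ((cycleKernel R.faceNext a (R.faceNext⁻¹ (R.coverInv v)) u -
        a * cycleKernel R.faceNext a (R.faceNext⁻¹ v) u) ^ 2 +
      ‖C 0 1‖ ^ 2 * cycleKernel R.faceNext a (R.faceNext⁻¹ v) u ^ 2 +
      ‖C 0 1‖ ^ 2 * cycleKernel R.faceNext a v u ^ 2) := by
  refine Finset.sum_congr rfl fun v _ => ?_
  simp only [equilibrium, faceFlow_single, faceNext_inv_apply, R.coverInv_coverInv, norm_mul,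
    norm_sheetSign, norm_twistSign, mul_one, one_mul, ← mul_assoc, ← sub_mul]
  norm_cast
  simp only [Real.norm_eq_abs, mul_pow, sq_abs]

lemma cycleKernel_inv_apply_inv_apply {ι : Type*} [Fintype ι] (σ : Equiv.Perm ι) (x y : ι) :
    cycleKernel σ a (σ⁻¹ x) (σ⁻¹ y) = cycleKernel σ a x y := by
  rw [← cycleKernel_apply_apply]
  congr 1 <;> exact σ.apply_symm_apply _

/-- Summing over the sources `u` produces entries of `K Kᵀ`. The squares carry the total coefficient
`1 + a² + 2|b|² = 2 + |b|²`; expanding the bridge term gives the cross term with coefficient `-2a`.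
-/
lemma sum_energy_equilibrium_single [DecidableEq (CoverArc G)] (ha0 : 0 ≤ a) (ha1 : a < 1)
    (hb : ‖C 0 1‖ ^ 2 = 1 - a ^ 2) :
    ∑ u, energy (equilibrium R C a (Pi.single u 1)) =
      (2 + ‖C 0 1‖ ^ 2) / ‖C 0 1‖ ^ 2 *
        ∑ v, (1 + a ^ cycleLength R.faceNext v) / (1 - a ^ cycleLength R.faceNext v) -
      2 * a / ‖C 0 1‖ ^ 2 * ∑ v, (cycleKernel R.faceNext a v (R.coverInv v) +
        cycleKernel R.faceNext a (R.coverInv v) v) := by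
  set K := cycleKernel R.faceNext a
  set φ := R.faceNext
  have hb0 : 1 - a ^ 2 ≠ 0 := (sub_pos.2 (pow_lt_one₀ ha0 ha1 two_ne_zero)).ne'
  set S : CoverArc G → ℝ := fun w => ∑ u, K w u ^ 2
  have hS : ∑ v, S v = (∑ v, (1 + a ^ cycleLength φ v) / (1 - a ^ cycleLength φ v)) /
      (1 - a ^ 2) := by
    rw [Finset.sum_div]
    refine Finset.sum_congr rfl fun v _ => ?_
    rw [eq_div_iff hb0, ← sum_cycleKernel_sq φ ha0 ha1, mul_comm]
  have hS1 : ∑ v, S (φ⁻¹ v) = ∑ v, S v := Equiv.sum_comp φ⁻¹ S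
  have hS2 : ∑ v, S (φ⁻¹ (R.coverInv v)) = ∑ v, S v := by
    rw [← hS1]
    exact Equiv.sum_comp R.coverInv fun v => S (φ⁻¹ v)
  have hcross (v : CoverArc G) : ∑ u, K (φ⁻¹ (R.coverInv v)) u * K (φ⁻¹ v) u =
      (K v (R.coverInv v) + K (R.coverInv v) v) / (1 - a ^ 2) := by
    -- The identity matrix in the kernel relation contributes nothing here, since `v̄ ≠ v`.
    rw [eq_div_iff hb0, mul_comm, sum_cycleKernel_mul_cycleKernel φ ha0 ha1,
      if_neg fun h => coverInv_ne R v (φ⁻¹.injective h), cycleKernel_inv_apply_inv_apply,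
      cycleKernel_inv_apply_inv_apply]
    ring
  have hu (v : CoverArc G) : ∑ u, ((K (φ⁻¹ (R.coverInv v)) u - a * K (φ⁻¹ v) u) ^ 2 +
      ‖C 0 1‖ ^ 2 * K (φ⁻¹ v) u ^ 2 + ‖C 0 1‖ ^ 2 * K v u ^ 2) =
      S (φ⁻¹ (R.coverInv v)) + a ^ 2 * S (φ⁻¹ v) -
        2 * a * ((K v (R.coverInv v) + K (R.coverInv v) v) / (1 - a ^ 2)) +
        ‖C 0 1‖ ^ 2 * S (φ⁻¹ v) + ‖C 0 1‖ ^ 2 * S v := by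
    rw [← hcross]
    simp only [S, Finset.mul_sum, ← Finset.sum_add_distrib, ← Finset.sum_sub_distrib]
    exact Finset.sum_congr rfl fun u _ => by ring
  simp only [energy_equilibrium_single]
  rw [Finset.sum_comm]
  simp only [K, φ] at hu ⊢
  simp only [hu, Finset.sum_add_distrib, Finset.sum_sub_distrib, ← Finset.mul_sum,
    ← Finset.sum_div]
  rw [← Finset.sum_add_distrib]
  simp only [K, φ] at hS hS1 hS2
  rw [hS1, hS2, hS, hb]
  field_simp
  ring

end Stationary

/-! ### From sums over arcs to sums over faces. -/

section Faces

variable {V : Type*} {G : SimpleGraph V} (R : RotationSystem G)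

/-- The face to which an arc of the double covering graph belongs. -/
def faceOf (v : CoverArc G) : R.Face := Quotient.mk R.faceSetoid v

lemma faceOf_eq_iff {v : CoverArc G} {f : R.Face} :
    faceOf R v = f ↔ R.faceNext.SameCycle (Quotient.out f) v ∨
      R.faceNext.SameCycle (Quotient.out f) (R.chiral v) := by
  have h : faceOf R v = f ↔ Quotient.mk R.faceSetoid (Quotient.out f) = faceOf R v := by
    rw [eq_comm]
    exact Eq.congr_left (Quotient.out_eq f).symm
  exact h.trans Quotient.eq

variable [Fintype G.Dart]

/-- The arcs of a face are those of the chosen walk and their chiral images. The two sets are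
disjoint because no facial walk is its own inverse. -/
lemma sum_eq_two_mul_sum_facialWalk (h : CoverArc G → ℝ) (hh : ∀ v, h (R.chiral v) = h v) :
    ∑ v, h v = 2 * ∑ f : R.Face, ∑ v ∈ R.facialWalk f, h v := by
  classical
  rw [← Finset.sum_fiberwise Finset.univ (faceOf R),
    Finset.mul_sum]
  refine Finset.sum_congr rfl fun f _ => ?_
  have hdisj : Disjoint (R.facialWalk f) ((R.facialWalk f).map R.chiral.toEmbedding) := by
    rw [Finset.disjoint_left]
    intro v hv hv'
    obtain ⟨w, hw, rfl⟩ := Finset.mem_map.1 hv'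
    simp only [RotationSystem.facialWalk, Finset.mem_filter, Finset.mem_univ, true_and] at hv hw
    exact R.not_sameCycle_chiral w (hw.symm.trans hv)
  have hfib : Finset.univ.filter (fun v => faceOf R v = f) =
      (R.facialWalk f).disjUnion _ hdisj := by
    ext v
    simp only [Finset.mem_filter, Finset.mem_univ, true_and, Finset.mem_disjUnion, faceOf_eq_iff,
      RotationSystem.facialWalk, Finset.mem_map_equiv]
    rw [show R.chiral.symm v = R.chiral v from R.chiral.symm_apply_eq.2 (R.chiral_chiral v).symm]
  rw [hfib, Finset.sum_disjUnion, Finset.sum_map]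
  simp [hh, two_mul]

lemma cycleLength_eq_faceLength {f : R.Face} {v : CoverArc G} (hv : v ∈ R.facialWalk f) :
    cycleLength R.faceNext v = R.faceLength f := by
  simp only [RotationSystem.facialWalk, Finset.mem_filter, Finset.mem_univ, true_and] at hv
  rw [← cycleLength_congr R.faceNext hv]
  unfold cycleLength RotationSystem.faceLength RotationSystem.facialWalk
  congr!

lemma sum_cycleLength_eq_sum_face (g : ℕ → ℝ) :
    ∑ v, g (cycleLength R.faceNext v) =
      2 * ∑ f : R.Face, (R.faceLength f : ℝ) * g (R.faceLength f) := by
  rw [sum_eq_two_mul_sum_facialWalk R _ fun v => by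
    rw [cycleLength_of_conj_eq_inv R.chiral_conj]]
  congr 1
  refine Finset.sum_congr rfl fun f _ => ?_
  rw [Finset.sum_congr rfl fun v hv => by rw [cycleLength_eq_faceLength R hv], Finset.sum_const,
    nsmul_eq_mul]
  rfl

lemma sum_cycleKernel_coverInv_eq_sum_face (a : ℝ) :
    ∑ v, (cycleKernel R.faceNext a v (R.coverInv v) + cycleKernel R.faceNext a (R.coverInv v) v) =
      2 * ∑ f : R.Face, (1 / (1 - a ^ R.faceLength f)) * ∑ e ∈ R.selfIntersections f,
        (a ^ R.faceDist e (R.coverInv e) + a ^ R.faceDist (R.coverInv e) e) := by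
  classical
  -- `chiral` commutes with `coverInv` and transposes the kernel, so it only exchanges the two
  -- summands.
  rw [sum_eq_two_mul_sum_facialWalk R _ fun v => by
    rw [← chiral_coverInv, cycleKernel_of_conj_eq_inv R.chiral_conj,
      cycleKernel_of_conj_eq_inv R.chiral_conj, add_comm]]
  congr 1
  refine Finset.sum_congr rfl fun f _ => ?_
  rw [RotationSystem.selfIntersections, Finset.sum_filter, Finset.mul_sum]
  refine Finset.sum_congr rfl fun v hv => ?_
  have hiff : R.coverInv v ∈ R.facialWalk f ↔ R.faceNext.SameCycle v (R.coverInv v) := by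
    simp only [RotationSystem.facialWalk, Finset.mem_filter, Finset.mem_univ, true_and] at hv ⊢
    exact ⟨hv.symm.trans, hv.trans⟩
  split_ifs with h
  · rw [cycleKernel_of_sameCycle _ (hiff.1 h), cycleKernel_of_sameCycle _ (hiff.1 h).symm,
      cycleLength_eq_faceLength R hv, cycleLength_eq_faceLength R h, ← add_div, div_eq_inv_mul,
      one_div]
    rfl
  · rw [cycleKernel_of_not_sameCycle _ fun h' => h (hiff.2 h'),
      cycleKernel_of_not_sameCycle _ fun h' => h (hiff.2 h'.symm)]
    simp

end Faces

end EmbeddedWalk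

/-! ### Assembly of the formula. -/

theorem theorem1p2 {V : Type*} [Fintype V] [DecidableEq V] (G : SimpleGraph V)
    [DecidableRel G.Adj] [Nonempty G.Dart] (R : EmbeddedWalk.RotationSystem G)
    (C : Matrix (Fin 2) (Fin 2) ℂ) (hC : C ∈ Matrix.unitaryGroup (Fin 2) ℂ)
    (hd : (C 1 1).im = 0) (hω : -C.det = 1)
    (a : ℝ) (ha : 0 < a) (haC : C 0 0 = (a : ℂ)) (hb : C 0 1 ≠ 0) :
    (∀ (α : EmbeddedWalk.CoverArc G → ℂ) (x : EmbeddedWalk.WalkArc G),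
      Tendsto (fun t : ℕ => EmbeddedWalk.walk R C α t x) atTop
        (𝓝 (EmbeddedWalk.stationaryState R C α x))) ∧
    EmbeddedWalk.meanComfortability R C =
      (1 / (Fintype.card G.Dart : ℝ)) * ((2 + ‖C 0 1‖ ^ 2) / (2 * ‖C 0 1‖ ^ 2)) *
          ∑ f : R.Face, (R.faceLength f : ℝ) *
            ((1 + a ^ R.faceLength f) / (1 - a ^ R.faceLength f)) -
        (1 / (Fintype.card G.Dart : ℝ)) * (a / ‖C 0 1‖ ^ 2) *
          ∑ f : R.Face, (1 / (1 - a ^ R.faceLength f)) *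
            ∑ e ∈ R.selfIntersections f,
              (a ^ R.faceDist e (R.coverInv e) + a ^ R.faceDist (R.coverInv e) e) := by
  have hdet : C.det = -1 := by rw [← hω, neg_neg]
  have hb2 : ‖C 0 1‖ ^ 2 = 1 - a ^ 2 := by
    have h := EmbeddedWalk.coin_norm_sq_row hC
    rw [haC, Complex.norm_real, Real.norm_eq_abs, sq_abs] at h
    linarith
  have hb0 : 0 < ‖C 0 1‖ ^ 2 := by positivity
  have ha1 : a < 1 := by nlinarith
  have hlim (α : EmbeddedWalk.CoverArc G → ℂ) (x : EmbeddedWalk.WalkArc G) :=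
    EmbeddedWalk.tendsto_walk_of_step_eq R hC hb
      (EmbeddedWalk.step_equilibrium R α hC hdet ha ha1 haC) (fun _ _ => rfl) x
  have hst (α : EmbeddedWalk.CoverArc G → ℂ) :
      EmbeddedWalk.stationaryState R C α = EmbeddedWalk.equilibrium R C a α :=
    funext fun x => (hlim α x).limUnder_eq
  refine ⟨fun α x => by rw [hst]; exact hlim α x, ?_⟩
  have hcard : (Fintype.card (EmbeddedWalk.CoverArc G) : ℝ) = 2 * Fintype.card G.Dart := by
    rw [Fintype.card_prod, ZMod.card]
    push_cast
    ring
  have hA : (Fintype.card G.Dart : ℝ) ≠ 0 := by simp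
  simp only [EmbeddedWalk.meanComfortability, EmbeddedWalk.comfortability, hst]
  rw [← Finset.mul_sum]
  have hE := EmbeddedWalk.sum_energy_equilibrium_single R (C := C) ha.le ha1 hb2
  simp only [EmbeddedWalk.energy] at hE
  rw [EmbeddedWalk.sum_cycleLength_eq_sum_face R fun n => (1 + a ^ n) / (1 - a ^ n),
    EmbeddedWalk.sum_cycleKernel_coverInv_eq_sum_face] at hE
  -- The factor `1 / (2|A|)` averages over the tails and `1 / 2` comes from the comfortability; the
  -- 2 from the two orientations of each face cancels one of these halves.
  convert congrArg (fun z => 1 / (2 * (Fintype.card G.Dart : ℝ)) * (1 / 2 * z)) hE using 1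
  · rw [hcard]
    congr!
  · field_simp
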